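/- Let $n\ge 1$, $r\ge 2$ and let $M_n=M_n(\mathbb C)$ carry the Hilbert–Schmidt inner product $\langle X,Y\rangle=\mathrm{Tr}\,X^*Y$. A subalgebra of $M_n$ means a unital $*$-subalgebra; $\mathcal A'$ denotes the commutant of $\mathcal A$ in $M_n$. Two subalgebras $\mathcal A,\mathcal B$ are called complementary if the subspaces $\mathcal A\ominus\mathbb C I$ and $\mathcal B\ominus\mathbb C I$ are orthogonal. For a subalgebra $\mathcal A$, the trace-preserving conditional expectation onto $\mathcal A$ is the unique positive linear map $E:M_n\to\mathcal A$ with $E(a)=a$, $E(aXb)=aE(X)b$ and $\mathrm{Tr}\,E(X)=\mathrm{Tr}\,X$ for all $a,b\in\mathcal A$, $X\in M_n$. Let $\mathcal A_1,\dots,\mathcal A_r$ be pairwise complementary subalgebras of $M_n$ such that their commutants $\mathcal A_1',\dots,\mathcal A_r'$ are pairwise complementary as well, and let $E_j$ be the trace-preserving conditional expectation of $M_n$ onto $\mathcal A_j$. (1) For every $j$, the algebra $\mathcal A_j'$ has an orthonormal basis one element of which is $\frac1{\sqrt n}I$, and for every orthonormal basis $U_{j1},\dots,U_{jn(j)}$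 of $\mathcal A_j'$ $$E_j(X)=\frac{n}{\dim\mathcal A_j'}\sum_{i=1}^{n(j)}U_{ji}^*XU_{ji}\qquad(X\in M_n).$$ (2) Suppose in addition that $\mathcal A_1,\dots,\mathcal A_r$ linearly span $M_n$ and that $\mathcal A_j\ne M_n$ for every $j$. Then for all $\lambda_1,\dots,\lambda_r\in\mathbb R$ the generalized Pauli channel $$\alpha(X)=\Big(1-\sum_{i=1}^r\lambda_i\Big)\frac{\mathrm{Tr}\,X}{n}I+\sum_{i=1}^r\lambda_iE_i(X)$$ is completely positive if and only if $$1+\frac{n^2\lambda_i}{\dim\mathcal A_i'}\ge\sum_{j=1}^r\lambda_j\quad\text{for every }1\le i\le r,\qquad\text{and}\qquad\sum_{j=1}^r\lambda_j\Big(\frac{n^2}{\dim\mathcal A_j'}-1\Big)\ge-1.$$ -/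

import Mathlib

open scoped ComplexOrder

noncomputable section

namespace PauliChannel

/-- `M_n`, the algebra of complex `n × n` matrices. -/
abbrev Mat (n : ℕ) : Type := Matrix (Fin n) (Fin n) ℂ

/-- The Hilbert–Schmidt inner product `⟨X, Y⟩ = Tr X* Y`. -/
def hsInner {n : ℕ} (X Y : Mat n) : ℂ := (X.conjTranspose * Y).trace

/-- The commutant `A'` of a unital *-subalgebra `A` of `M_n`. -/
def commutant {n : ℕ} (A : StarSubalgebra ℂ (Mat n)) : StarSubalgebra ℂ (Mat n) :=
  StarSubalgebra.centralizer ℂ (A : Set (Mat n))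

/-- The complex dimension of a *-subalgebra. -/
def dim {n : ℕ} (A : StarSubalgebra ℂ (Mat n)) : ℕ := Module.finrank ℂ A

/-- `A` and `B` are complementary: `A ⊖ ℂI` and `B ⊖ ℂI` are orthogonal with respect to the
Hilbert–Schmidt inner product, where `A ⊖ ℂI` consists of the elements of `A` orthogonal to `I`. -/
def Complementary {n : ℕ} (A B : StarSubalgebra ℂ (Mat n)) : Prop :=
  ∀ a ∈ A, ∀ b ∈ B, hsInner 1 a = 0 → hsInner 1 b = 0 → hsInner a b = 0

/-- `U 0, …, U (m-1)` is an orthonormal basis of `A` for the Hilbert–Schmidt inner product. -/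
structure IsOrthonormalBasis {n m : ℕ} (A : StarSubalgebra ℂ (Mat n)) (U : Fin m → Mat n) :
    Prop where
  mem : ∀ i, U i ∈ A
  orthonormal : ∀ i k, hsInner (U i) (U k) = if i = k then 1 else 0
  span_eq : Submodule.span ℂ (Set.range U) = A.toSubalgebra.toSubmodule

/-- `E` is a trace-preserving conditional expectation of `M_n` onto `A`: a positive linear
projection of `M_n` onto `A` with the `A`-bimodule property, which preserves the trace. -/
structure IsTracePreservingCondExp {n : ℕ} (A : StarSubalgebra ℂ (Mat n))
    (E : Mat n →ₗ[ℂ] Mat n) : Prop where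
  map_mem : ∀ X, E X ∈ A
  map_of_mem : ∀ a ∈ A, E a = a
  bimodule : ∀ a ∈ A, ∀ b ∈ A, ∀ X, E (a * X * b) = a * E X * b
  posSemidef : ∀ X, X.PosSemidef → (E X).PosSemidef
  trace_eq : ∀ X, (E X).trace = X.trace

theorem exists_projection {V : Type} [NormedAddCommGroup V] [InnerProductSpace ℂ V]
    [FiniteDimensional ℂ V] (S : Submodule ℂ V) :
    ∃ P : V →ₗ[ℂ] V, ∀ X, P X ∈ S ∧ ∀ a ∈ S, inner ℂ a (X - P X) = 0 :=
  ⟨S.starProjection.toLinearMap, fun X => ⟨S.starProjection_apply_mem X, fun a ha =>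
    S.sub_starProjection_mem_orthogonal X a ha⟩⟩

theorem exists_orthogonal_projection {n : ℕ} (S : Submodule ℂ (Mat n)) :
    ∃ P : Mat n →ₗ[ℂ] Mat n, ∀ X, P X ∈ S ∧ ∀ a ∈ S, hsInner a (X - P X) = 0 := by
  obtain ⟨P, hP⟩ := @exists_projection (Mat n)
    (Matrix.toMatrixNormedAddCommGroup (1 : Mat n) Matrix.PosDef.one)
    (Matrix.toMatrixInnerProductSpace (1 : Mat n) Matrix.PosSemidef.one)
    (inferInstanceAs (FiniteDimensional ℂ (Mat n))) S
  refine ⟨P, fun X => ⟨(hP X).1, fun a ha => ?_⟩⟩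
  have h2 : ((X - P X) * 1 * a.conjTranspose).trace = 0 := (hP X).2 a ha
  rw [mul_one, Matrix.trace_mul_comm] at h2
  exact h2

theorem eq_of_orthogonal {n : ℕ} (A : StarSubalgebra ℂ (Mat n)) {X Y Z : Mat n}
    (hY : Y ∈ A) (hZ : Z ∈ A) (h1 : ∀ a ∈ A, hsInner a (X - Y) = 0)
    (h2 : ∀ a ∈ A, hsInner a (X - Z) = 0) : Y = Z := by
  have h : hsInner (Y - Z) (Y - Z) = 0 := by
    have e1 := h1 _ (sub_mem hY hZ)
    have e2 := h2 _ (sub_mem hY hZ)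
    simp only [hsInner, Matrix.mul_sub, Matrix.trace_sub] at e1 e2 ⊢
    linear_combination e2 - e1
  exact sub_eq_zero.mp (Matrix.trace_conjTranspose_mul_self_eq_zero_iff.mp h)

open scoped MatrixOrder in
theorem posSemidef_of_orthogonal {n : ℕ} (A : StarSubalgebra ℂ (Mat n)) {X Y : Mat n}
    (hX : X.PosSemidef) (hY : Y ∈ A) (hYh : Y.IsHermitian)
    (h : ∀ a ∈ A, hsInner a (X - Y) = 0) : Y.PosSemidef := by
  have hsa : IsSelfAdjoint Y := hYh
  have hcl : IsClosed (A : Set (Mat n)) :=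
    Submodule.closed_of_finiteDimensional A.toSubalgebra.toSubmodule
  have hN0 : (0 : Mat n) ≤ Y⁻ := CFC.negPart_nonneg Y
  have hNh : (Y⁻).conjTranspose = Y⁻ := (Matrix.nonneg_iff_posSemidef.mp hN0).isHermitian
  have hNA : Y⁻ ∈ A := by
    rw [CFC.negPart_def, cfcₙ_eq_cfc]
    exact cfc_mem (𝕜' := ℂ) (hs := hcl) _ hY
  have e := h _ hNA
  have hYN : Y⁻ * Y = -(Y⁻ * Y⁻) := by
    have h1 : Y⁻ * (Y⁺ - Y⁻) = -(Y⁻ * Y⁻) := by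
      rw [mul_sub, CFC.negPart_mul_posPart, zero_sub]
    rwa [CFC.posPart_sub_negPart Y hsa] at h1
  have hpos : 0 ≤ (Y⁻ * X).trace := by
    obtain ⟨B, hB⟩ := CStarAlgebra.nonneg_iff_eq_star_mul_self.mp hN0
    rw [hB, mul_assoc, Matrix.trace_mul_comm]
    exact (hX.mul_mul_conjTranspose_same B).trace_nonneg
  have hpos2 : 0 ≤ ((Y⁻).conjTranspose * Y⁻).trace :=
    (Matrix.posSemidef_conjTranspose_mul_self _).trace_nonneg
  have hz : ((Y⁻).conjTranspose * Y⁻).trace = 0 := by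
    refine le_antisymm ?_ hpos2
    rw [hsInner, hNh, mul_sub, hYN, sub_neg_eq_add, Matrix.trace_add] at e
    rw [hNh, ← neg_nonneg, ← eq_neg_of_add_eq_zero_left e]
    exact hpos
  have hN : Y⁻ = 0 := Matrix.trace_conjTranspose_mul_self_eq_zero_iff.mp hz
  exact Matrix.nonneg_iff_posSemidef.mp ((CFC.negPart_eq_zero_iff Y hsa).mp hN)

theorem IsTracePreservingCondExp.orthogonal {n : ℕ} {A : StarSubalgebra ℂ (Mat n)}
    {E : Mat n →ₗ[ℂ] Mat n} (hE : IsTracePreservingCondExp A E) (X : Mat n) :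
    ∀ a ∈ A, hsInner a (X - E X) = 0 := by
  intro a ha
  have h := hE.bimodule _ (star_mem ha) 1 (one_mem A) X
  rw [mul_one, mul_one] at h
  have h2 := hE.trace_eq (star a * X)
  rw [h] at h2
  rw [hsInner, mul_sub, Matrix.trace_sub]
  exact sub_eq_zero.mpr h2.symm

/-- There is exactly one trace-preserving conditional expectation of `M_n` onto `A`. -/
theorem existsUnique_condExp {n : ℕ} (A : StarSubalgebra ℂ (Mat n)) :
    ∃! E : Mat n →ₗ[ℂ] Mat n, IsTracePreservingCondExp A E := by
  obtain ⟨P, hP⟩ := exists_orthogonal_projection A.toSubalgebra.toSubmodule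
  have hm : ∀ X, P X ∈ A := fun X => (hP X).1
  have ho : ∀ X, ∀ a ∈ A, hsInner a (X - P X) = 0 := fun X a ha => (hP X).2 a ha
  have hstar : ∀ X, P (star X) = star (P X) := by
    intro X
    refine eq_of_orthogonal A (hm _) (star_mem (hm X)) (ho _) fun a ha => ?_
    have h := congrArg star (ho X _ (star_mem ha))
    rw [hsInner, ← Matrix.trace_conjTranspose, Matrix.conjTranspose_mul, star_zero,
      Matrix.conjTranspose_conjTranspose, Matrix.trace_mul_comm] at h
    rw [hsInner, ← star_sub]
    exact h
  refine ⟨P, ⟨hm, fun a ha => ?_, fun a ha b hb X => ?_, fun X hX => ?_, fun X => ?_⟩, ?_⟩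
  · refine eq_of_orthogonal A (hm _) ha (ho _) fun c _ => ?_
    rw [sub_self, hsInner, mul_zero, Matrix.trace_zero]
  · refine eq_of_orthogonal A (hm _) (mul_mem (mul_mem ha (hm X)) hb) (ho _) fun c hc => ?_
    have h := ho X _ (mul_mem (mul_mem (star_mem ha) hc) (star_mem hb))
    rw [hsInner] at h ⊢
    rw [← Matrix.star_eq_conjTranspose, star_mul, star_mul, star_star, star_star, mul_assoc,
      Matrix.trace_mul_comm] at h
    rw [← h]
    congr 1
    rw [← Matrix.star_eq_conjTranspose]
    noncomm_ring
  · refine posSemidef_of_orthogonal A hX (hm X) ?_ (ho X)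
    have h := hstar X
    rw [Matrix.star_eq_conjTranspose, hX.isHermitian.eq] at h
    exact h.symm
  · have h := ho X 1 (one_mem A)
    rw [hsInner, Matrix.conjTranspose_one, one_mul, Matrix.trace_sub] at h
    exact (sub_eq_zero.mp h).symm
  · intro E hE
    exact LinearMap.ext fun X =>
      eq_of_orthogonal A (hE.map_mem X) (hm X) (hE.orthogonal X) (ho X)

/-- The trace-preserving conditional expectation of `M_n` onto `A`. -/
def condExp {n : ℕ} (A : StarSubalgebra ℂ (Mat n)) : Mat n →ₗ[ℂ] Mat n :=
  (existsUnique_condExp A).choose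

theorem condExp_spec {n : ℕ} (A : StarSubalgebra ℂ (Mat n)) :
    IsTracePreservingCondExp A (condExp A) :=
  (existsUnique_condExp A).choose_spec.1

/-- The generalized Pauli channel
`α(X) = (1 - ∑ i, lam i) (Tr X / n) I + ∑ i, lam i • E_i(X)`. -/
def pauliChannel {n r : ℕ} (A : Fin r → StarSubalgebra ℂ (Mat n)) (lam : Fin r → ℝ) :
    Mat n →ₗ[ℂ] Mat n :=
  ((1 - ∑ i, (lam i : ℂ)) / (n : ℂ)) • (Matrix.traceLinearMap (Fin n) ℂ ℂ).smulRight (1 : Mat n)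
    + ∑ i, (lam i : ℂ) • condExp (A i)

/-- The ampliation `id_k ⊗ Φ`, applied to a `k × k` block matrix with blocks in `M_n`. -/
def ampliation {n : ℕ} (Φ : Mat n →ₗ[ℂ] Mat n) (k : ℕ)
    (M : Matrix (Fin k × Fin n) (Fin k × Fin n) ℂ) :
    Matrix (Fin k × Fin n) (Fin k × Fin n) ℂ :=
  Matrix.of fun p q => Φ (Matrix.of fun a b => M (p.1, a) (q.1, b)) p.2 q.2

/-- Complete positivity: every ampliation preserves positive semidefiniteness. -/
def IsCompletelyPositive {n : ℕ} (Φ : Mat n →ₗ[ℂ] Mat n) : Prop :=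
  ∀ (k : ℕ) (M : Matrix (Fin k × Fin n) (Fin k × Fin n) ℂ),
    M.PosSemidef → (ampliation Φ k M).PosSemidef

end PauliChannel

end

/-!
For a subalgebra `A` of `M_n` let `U` be an orthonormal basis of the commutant `A'` and `V` one of
`A`. The map `T(X) = ∑ i, (U i)ᴴ X (U i)` takes values in `A'' = A`, is an `A`-bimodule map and is
symmetric for the Hilbert–Schmidt inner product, so `T(X) = z E(X)`, where `E` is the conditional
expectation and `z = T(1)` lies in the centre of `A` (`krausMap_eq_mul_condExp`). The first
assertion says that `z` is a scalar.

The trace of the superoperator `X ↦ T(cX)`, for `c` in the centre, can be computed from the Kraus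
form and from `T = z E`. This yields `Tr(c z w) = Tr c` with `w = ∑ j, (V j) (V j)ᴴ`. Expanding
`∑ j, ‖(V j)ᴴ (z - s)‖² ≥ 0` for real `s` then gives `dim A * dim A' ≥ n²`, with equality only for
scalar `z` (`sq_le_dim_mul_dim_commutant`, `krausMap_one_of_dim_mul_dim_commutant`). Complementary
subalgebras satisfy `dim A * dim B ≤ n²`, because the products of the members of two orthonormal
bases are orthogonal. When `A, B` and `A', B'` are both complementary, the four inequalities force
equality everywhere (`dim_mul_eq_of_complementary`).

If moreover proper subalgebras `A_j` span `M_n`, then `∑ j, (dim A_j - 1) = n² - 1`, and together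
with `dim A_i * dim A_j = n²` this gives `dim A_j = dim A_j' = n` and `r = n + 1`. Since `M_n` is
the orthogonal sum of `ℂ I` and the `A_j ⊖ ℂ I`, one has `Tr(X) I = X / n + ∑ j, (E_j(X) - X / n)`,
and hence `α` is the combination of `X ↦ X` and the maps `X ↦ E_j(X) - X / n` whose coefficients
are, up to positive factors, the quantities in the two conditions (`pauliChannel_eq`). These maps
are completely positive: by the first assertion `E_j(X) - X / n` is the Kraus sum over a basis of
`A_j' ⊖ ℂ I`. Conversely, the Choi form of `α` at `I` and at a unit vector of `A_j' ⊖ ℂ I` picks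
out the individual coefficients, so complete positivity makes each of them nonnegative.
-/

noncomputable section

namespace PauliChannel

variable {n m : ℕ}

/-! ### The Hilbert–Schmidt inner product -/

theorem star_hsInner (X Y : Mat n) : star (hsInner X Y) = hsInner Y X := by
  rw [hsInner, hsInner, ← Matrix.trace_conjTranspose, Matrix.conjTranspose_mul,
    Matrix.conjTranspose_conjTranspose]

theorem hsInner_sum_right {ι : Type*} (s : Finset ι) (X : Mat n) (F : ι → Mat n) :
    hsInner X (∑ i ∈ s, F i) = ∑ i ∈ s, hsInner X (F i) := by
  simp only [hsInner, Matrix.mul_sum, Matrix.trace_sum]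

theorem hsInner_smul_right (c : ℂ) (X Y : Mat n) : hsInner X (c • Y) = c * hsInner X Y := by
  simp only [hsInner, Matrix.mul_smul, Matrix.trace_smul, smul_eq_mul]

theorem hsInner_sub_right (X Y Z : Mat n) : hsInner X (Y - Z) = hsInner X Y - hsInner X Z := by
  simp only [hsInner, mul_sub, Matrix.trace_sub]

theorem hsInner_one_left (X : Mat n) : hsInner 1 X = X.trace := by
  rw [hsInner, Matrix.conjTranspose_one, one_mul]

theorem hsInner_one_one : hsInner (1 : Mat n) 1 = n := by
  rw [hsInner_one_left, Matrix.trace_one, Fintype.card_fin]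

theorem hsInner_self_nonneg (X : Mat n) : 0 ≤ hsInner X X :=
  (Matrix.posSemidef_conjTranspose_mul_self X).trace_nonneg

theorem hsInner_self_eq_zero {X : Mat n} : hsInner X X = 0 ↔ X = 0 :=
  Matrix.trace_conjTranspose_mul_self_eq_zero_iff

theorem linearIndependent_of_hsInner {ι : Type*} [DecidableEq ι] {F : ι → Mat n} {c : ℂ}
    (hc : c ≠ 0) (hF : ∀ i k, hsInner (F i) (F k) = if i = k then c else 0) :
    LinearIndependent ℂ F := by
  rw [linearIndependent_iff']
  intro s g hg i hi
  have h : hsInner (F i) (∑ k ∈ s, g k • F k) = g i * c := by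
    rw [hsInner_sum_right]
    simp only [hsInner_smul_right, hF, mul_ite, mul_zero, Finset.sum_ite_eq, hi, if_true]
  rw [hg, hsInner, mul_zero, Matrix.trace_zero] at h
  exact (mul_eq_zero.mp h.symm).resolve_right hc

namespace IsOrthonormalBasis

variable {A : StarSubalgebra ℂ (Mat n)} {U : Fin m → Mat n}

theorem sum_hsInner_smul (hU : IsOrthonormalBasis A U) {X : Mat n} (hX : X ∈ A) :
    ∑ i, hsInner (U i) X • U i = X := by
  have h : X ∈ Submodule.span ℂ (Set.range U) := by rw [hU.span_eq]; exact hX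
  obtain ⟨c, rfl⟩ := (Submodule.mem_span_range_iff_exists_fun ℂ).mp h
  refine Finset.sum_congr rfl fun i _ => ?_
  rw [hsInner_sum_right]
  simp only [hsInner_smul_right, hU.orthonormal, mul_ite, mul_one, mul_zero, Finset.sum_ite_eq,
    Finset.mem_univ, if_true]

theorem linearIndependent (hU : IsOrthonormalBasis A U) : LinearIndependent ℂ U :=
  linearIndependent_of_hsInner one_ne_zero hU.orthonormal

theorem dim_eq (hU : IsOrthonormalBasis A U) : dim A = m := by
  have h := finrank_span_eq_card hU.linearIndependent
  rw [hU.span_eq, Fintype.card_fin] at h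
  exact h

/-- The conditional expectation is the orthogonal projection, expanded in an orthonormal basis. -/
theorem condExp_eq (hU : IsOrthonormalBasis A U) (X : Mat n) :
    condExp A X = ∑ i, hsInner (U i) X • U i := by
  have h := condExp_spec A
  rw [← hU.sum_hsInner_smul (h.map_mem X)]
  refine Finset.sum_congr rfl fun i _ => ?_
  have ho := h.orthogonal X (U i) (hU.mem i)
  rw [hsInner_sub_right] at ho
  rw [sub_eq_zero.mp ho]

/-- Changing the orthonormal basis `U` into the orthonormal basis of the adjoints leaves
`∑ i, (U i)ᴴ ⊗ U i` invariant. -/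
theorem sum_conjTranspose_mul_mul (hU : IsOrthonormalBasis A U) (X : Mat n) :
    ∑ i, (U i).conjTranspose * X * U i = ∑ i, U i * X * (U i).conjTranspose := by
  have e1 : ∀ i, (U i).conjTranspose = ∑ k, hsInner (U k) (U i).conjTranspose • U k :=
    fun i => (hU.sum_hsInner_smul (star_mem (hU.mem i))).symm
  calc ∑ i, (U i).conjTranspose * X * U i
      = ∑ i, ∑ k, hsInner (U k) (U i).conjTranspose • (U k * X * U i) := by
        refine Finset.sum_congr rfl fun i _ => ?_
        conv_lhs => rw [e1 i]
        simp only [Finset.sum_mul, Matrix.smul_mul]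
    _ = ∑ k, ∑ i, hsInner (U i) (U k).conjTranspose • (U k * X * U i) := by
        rw [Finset.sum_comm]
        refine Finset.sum_congr rfl fun k _ => Finset.sum_congr rfl fun i _ => ?_
        rw [hsInner, hsInner, Matrix.trace_mul_comm]
    _ = ∑ i, U i * X * (U i).conjTranspose := by
        refine Finset.sum_congr rfl fun i _ => ?_
        conv_rhs => rw [e1 i]
        simp only [Finset.mul_sum, Matrix.mul_smul]

end IsOrthonormalBasis

theorem exists_isOrthonormalBasis (hn : 1 ≤ n) (A : StarSubalgebra ℂ (Mat n)) :
    ∃ (m : ℕ) (U : Fin m → Mat n), IsOrthonormalBasis A U ∧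
      ∃ i, U i = ((1 / Real.sqrt n : ℝ) : ℂ) • (1 : Mat n) := by
  let _ := Matrix.toMatrixNormedAddCommGroup (1 : Mat n) Matrix.PosDef.one
  let _ := Matrix.toMatrixInnerProductSpace (1 : Mat n) Matrix.PosSemidef.one
  have : FiniteDimensional ℂ (Mat n) := inferInstanceAs (FiniteDimensional ℂ (Mat n))
  have hin : ∀ X Y : Mat n, inner ℂ X Y = hsInner X Y := fun X Y => by
    have : (Y * 1 * X.conjTranspose).trace = hsInner X Y := by
      rw [mul_one, Matrix.trace_mul_comm, hsInner]
    exact this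
  set S : Submodule ℂ (Mat n) := A.toSubalgebra.toSubmodule
  set u : Mat n := ((1 / Real.sqrt n : ℝ) : ℂ) • (1 : Mat n) with hu
  have huS : u ∈ S := A.smul_mem (one_mem A) _
  have hun : hsInner u u = 1 := by
    have h0 : (Real.sqrt n : ℂ) * Real.sqrt n = n := by
      rw [← Complex.ofReal_mul, Real.mul_self_sqrt (Nat.cast_nonneg n), Complex.ofReal_natCast]
    have h1 : (n : ℂ) ≠ 0 := by exact_mod_cast (by omega : n ≠ 0)
    have h2 : (Real.sqrt n : ℂ) ≠ 0 := by
      intro h; rw [h, zero_mul] at h0; exact h1 h0.symm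
    rw [hsInner_smul_right, ← star_hsInner, hsInner_smul_right, hsInner_one_one]
    simp only [star_mul', Complex.star_def, Complex.conj_ofReal, Complex.conj_natCast]
    push_cast
    field_simp
    rw [sq, h0]
  have hcard : Module.finrank ℂ S = Fintype.card (Fin (Module.finrank ℂ S)) :=
    (Fintype.card_fin _).symm
  have hpos : 0 < Module.finrank ℂ S := by
    have _ : Nontrivial S := ⟨⟨⟨u, huS⟩, 0, fun h => by
      have h3 : u = 0 := congrArg Subtype.val h
      rw [h3, hsInner, mul_zero, Matrix.trace_zero] at hun
      exact zero_ne_one hun⟩⟩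
    exact Module.finrank_pos
  have hort : Orthonormal ℂ (({⟨0, hpos⟩} : Set (Fin (Module.finrank ℂ S))).domRestrict
      fun _ => (⟨u, huS⟩ : S)) := by
    rw [orthonormal_iff_ite]
    intro i k
    rw [Subsingleton.elim k i, if_pos rfl]
    exact (hin u u).trans hun
  obtain ⟨b, hb⟩ := Orthonormal.exists_orthonormalBasis_extension_of_card_eq hcard hort
  refine ⟨_, fun i => (b i : Mat n), ⟨fun i => (b i).2, fun i k => ?_, ?_⟩, ⟨0, hpos⟩, ?_⟩
  · rw [← hin]
    exact orthonormal_iff_ite.mp b.orthonormal i k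
  · have h := congrArg (Submodule.map S.subtype) b.toBasis.span_eq
    rw [Submodule.map_span, Submodule.map_subtype_top, ← Set.range_comp] at h
    simpa [Function.comp_def] using h
  · exact congrArg Subtype.val (hb _ rfl)

/-! ### The double commutant theorem -/

theorem mem_commutant_iff {A : StarSubalgebra ℂ (Mat n)} {X : Mat n} :
    X ∈ commutant A ↔ ∀ a ∈ A, a * X = X * a := by
  rw [commutant, StarSubalgebra.mem_centralizer_iff]
  exact ⟨fun h a ha => (h a ha).1, fun h a ha => ⟨h a ha, h _ (star_mem ha)⟩⟩

/-- The matrix of the linear map that embeds `ℂⁿ` into `M_n` as the column `p`, applies `E`, and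
extracts the column `q`. -/
def columnBlock (E : Mat n →ₗ[ℂ] Mat n) (p q : Fin n) : Mat n :=
  Matrix.of fun i k => E (Matrix.single k p 1) i q

theorem columnBlock_apply_sum (E : Mat n →ₗ[ℂ] Mat n) (X : Mat n) (i q : Fin n) :
    E X i q = ∑ p, (columnBlock E p q * X) i p := by
  conv_lhs => rw [Matrix.matrix_eq_sum_single X]
  simp only [map_sum, Matrix.sum_apply, Matrix.mul_apply, columnBlock, Matrix.of_apply]
  rw [Finset.sum_comm]
  refine Finset.sum_congr rfl fun p _ => Finset.sum_congr rfl fun k _ => ?_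
  have h : Matrix.single k p (X k p) = X k p • Matrix.single k p (1 : ℂ) := by
    rw [Matrix.smul_single, smul_eq_mul, mul_one]
  rw [h, map_smul, Matrix.smul_apply, smul_eq_mul, mul_comm]

/-- The conditional expectation commutes with left multiplication by `A`, so its column blocks lie
in `A'`; hence it commutes with left multiplication by `A''`, and fixes `A'' · 1`. -/
theorem commutant_commutant (A : StarSubalgebra ℂ (Mat n)) : commutant (commutant A) = A := by
  refine le_antisymm (fun b hb => ?_) fun a ha =>
    mem_commutant_iff.mpr fun c hc => (mem_commutant_iff.mp hc a ha).symm
  have hE := condExp_spec A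
  have hleft : ∀ a ∈ A, ∀ X, condExp A (a * X) = a * condExp A X := fun a ha X => by
    simpa only [mul_one] using hE.bimodule a ha 1 (one_mem A) X
  have hblock : ∀ p q, columnBlock (condExp A) p q ∈ commutant A := by
    intro p q
    refine mem_commutant_iff.mpr fun a ha => ?_
    ext i k
    have h := congrFun (congrFun (hleft a ha (Matrix.single k p 1)) i) q
    rw [columnBlock_apply_sum] at h
    have h2 : ∀ p', (columnBlock (condExp A) p' q * (a * Matrix.single k p 1) : Mat n) i p' =
        if p = p' then (columnBlock (condExp A) p' q * a : Mat n) i k else 0 := by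
      intro p'
      rw [← mul_assoc]
      split_ifs with hp
      · subst hp; simp
      · rw [Matrix.mul_single_apply_of_ne _ _ _ _ _ (Ne.symm hp)]
    simp only [h2, Finset.sum_ite_eq, Finset.mem_univ, if_true] at h
    rw [h]
    rw [Matrix.mul_apply]
    simp only [Matrix.mul_apply, columnBlock, Matrix.of_apply]
  have hb1 : condExp A (b * 1) = b * condExp A 1 := by
    ext i q
    rw [columnBlock_apply_sum, Matrix.mul_apply]
    simp only [columnBlock_apply_sum]
    simp only [Finset.mul_sum]
    rw [Finset.sum_comm]
    refine Finset.sum_congr rfl fun p _ => ?_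
    rw [← mul_assoc, mem_commutant_iff.mp hb _ (hblock p q), mul_assoc, Matrix.mul_apply]
  rw [hE.map_of_mem 1 (one_mem A), mul_one] at hb1
  rw [← hb1]
  exact hE.map_mem b

/-! ### Superoperators and their traces -/

/-- The map `X ↦ ∑ i, (U i)ᴴ X (U i)` with Kraus operators `U i`. -/
def krausMap (U : Fin m → Mat n) : Mat n →ₗ[ℂ] Mat n :=
  ∑ i, LinearMap.mulLeft ℂ (U i).conjTranspose ∘ₗ LinearMap.mulRight ℂ (U i)

theorem krausMap_apply (U : Fin m → Mat n) (X : Mat n) :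
    krausMap U X = ∑ i, (U i).conjTranspose * X * U i := by
  simp [krausMap, LinearMap.sum_apply, mul_assoc]

theorem trace_eq_sum_single (Φ : Mat n →ₗ[ℂ] Mat n) :
    LinearMap.trace ℂ (Mat n) Φ = ∑ p, ∑ q, Φ (Matrix.single p q 1) p q := by
  have h : Φ = ∑ p, ∑ q, (Matrix.entryLinearMap ℂ ℂ p q : Mat n →ₗ[ℂ] ℂ).smulRight
      (Φ (Matrix.single p q 1)) := by
    refine LinearMap.ext fun X => ?_
    simp only [LinearMap.sum_apply, LinearMap.smulRight_apply, Matrix.entryLinearMap_apply]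
    conv_lhs => rw [Matrix.matrix_eq_sum_single X]
    simp only [map_sum]
    refine Finset.sum_congr rfl fun p _ => Finset.sum_congr rfl fun q _ => ?_
    rw [← map_smul, Matrix.smul_single, smul_eq_mul, mul_one]
  conv_lhs => rw [h]
  simp only [map_sum, LinearMap.trace_smulRight, Matrix.entryLinearMap_apply]

theorem trace_mulLeft_comp_mulRight (P Q : Mat n) :
    LinearMap.trace ℂ (Mat n) (LinearMap.mulLeft ℂ P ∘ₗ LinearMap.mulRight ℂ Q) =
      P.trace * Q.trace := by
  have e : ∀ i j, (P * (Matrix.single i j 1 * Q) : Mat n) i j = P i i * Q j j := by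
    intro i j
    simp [Matrix.mul_apply, Matrix.single_apply, ite_and]
  rw [trace_eq_sum_single]
  simp only [LinearMap.comp_apply, LinearMap.mulLeft_apply, LinearMap.mulRight_apply, e]
  rw [Matrix.trace, Matrix.trace, Finset.sum_mul_sum]
  rfl

theorem trace_mulLeft_comp_condExp {A : StarSubalgebra ℂ (Mat n)} {V : Fin m → Mat n}
    (hV : IsOrthonormalBasis A V) (c : Mat n) :
    LinearMap.trace ℂ (Mat n) (LinearMap.mulLeft ℂ c ∘ₗ condExp A) =
      (c * ∑ j, V j * (V j).conjTranspose).trace := by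
  have h : LinearMap.mulLeft ℂ c ∘ₗ condExp A = ∑ j,
      ((Matrix.traceLinearMap (Fin n) ℂ ℂ) ∘ₗ
        LinearMap.mulLeft ℂ (V j).conjTranspose).smulRight (c * V j) := by
    refine LinearMap.ext fun X => ?_
    simp only [LinearMap.comp_apply, LinearMap.mulLeft_apply, hV.condExp_eq,
      LinearMap.sum_apply, LinearMap.smulRight_apply, Matrix.traceLinearMap_apply,
      Finset.mul_sum, Matrix.mul_smul, hsInner]
  rw [h]
  simp only [map_sum, LinearMap.trace_smulRight, LinearMap.comp_apply, LinearMap.mulLeft_apply,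
    Matrix.traceLinearMap_apply, Finset.mul_sum, Matrix.trace_sum]
  refine Finset.sum_congr rfl fun j _ => ?_
  rw [Matrix.trace_mul_comm, mul_assoc]

theorem trace_condExp {n : ℕ} (hn : 1 ≤ n) (A : StarSubalgebra ℂ (Mat n)) :
    LinearMap.trace ℂ (Mat n) (condExp A) = dim A := by
  obtain ⟨m, V, hV, -⟩ := exists_isOrthonormalBasis hn A
  have h := trace_mulLeft_comp_condExp hV 1
  rw [LinearMap.mulLeft_one, LinearMap.id_comp, one_mul, Matrix.trace_sum] at h
  rw [h, hV.dim_eq]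
  have e : ∀ j, (V j * (V j).conjTranspose).trace = 1 := fun j => by
    rw [Matrix.trace_mul_comm]
    exact (hV.orthonormal j j).trans (if_pos rfl)
  simp [e]

/-! ### The Kraus map of an orthonormal basis of the commutant -/

section Commutant

variable {A : StarSubalgebra ℂ (Mat n)} {U : Fin m → Mat n}

theorem krausMap_mem (hU : IsOrthonormalBasis (commutant A) U) (X : Mat n) :
    krausMap U X ∈ A := by
  rw [← commutant_commutant A, mem_commutant_iff]
  intro v hv
  rw [krausMap_apply, Finset.mul_sum, Finset.sum_mul]
  have e1 : ∀ i, U i * v = ∑ k, hsInner (U k) (U i * v) • U k :=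
    fun i => (hU.sum_hsInner_smul (mul_mem (hU.mem i) hv)).symm
  have e2 : ∀ k, v * (U k).conjTranspose =
      ∑ i, hsInner (U k) (U i * v) • (U i).conjTranspose := by
    intro k
    have h := congrArg Matrix.conjTranspose
      (hU.sum_hsInner_smul (mul_mem (hU.mem k) (star_mem hv)))
    rw [Matrix.conjTranspose_sum, Matrix.conjTranspose_mul, Matrix.star_eq_conjTranspose,
      Matrix.conjTranspose_conjTranspose] at h
    rw [← h]
    refine Finset.sum_congr rfl fun i _ => ?_
    rw [Matrix.conjTranspose_smul, star_hsInner, hsInner, hsInner, Matrix.conjTranspose_mul,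
      Matrix.conjTranspose_conjTranspose, mul_assoc, Matrix.trace_mul_comm, mul_assoc]
  calc ∑ k, v * ((U k).conjTranspose * X * U k)
      = ∑ k, ∑ i, hsInner (U k) (U i * v) • ((U i).conjTranspose * X * U k) := by
        refine Finset.sum_congr rfl fun k _ => ?_
        rw [← mul_assoc, ← mul_assoc, e2 k]
        simp only [Finset.sum_mul, Matrix.smul_mul]
    _ = ∑ i, (U i).conjTranspose * X * U i * v := by
        rw [Finset.sum_comm]
        refine Finset.sum_congr rfl fun i _ => ?_
        conv_rhs => rw [mul_assoc, e1 i]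
        simp only [Finset.mul_sum, Matrix.mul_smul]

theorem krausMap_mul_left (hU : ∀ i, U i ∈ commutant A) {a : Mat n} (ha : a ∈ A) (X : Mat n) :
    krausMap U (a * X) = a * krausMap U X := by
  rw [krausMap_apply, krausMap_apply, Finset.mul_sum]
  refine Finset.sum_congr rfl fun i _ => ?_
  have h := mem_commutant_iff.mp (star_mem (hU i)) a ha
  rw [Matrix.star_eq_conjTranspose] at h
  rw [← mul_assoc, ← mul_assoc, ← mul_assoc, h]

theorem krausMap_one_mem_commutant (hU : ∀ i, U i ∈ commutant A) :
    krausMap U 1 ∈ commutant A := by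
  rw [krausMap_apply]
  exact sum_mem fun i _ => mul_mem (mul_mem (star_mem (hU i)) (one_mem _)) (hU i)

theorem krausMap_one_isHermitian (U : Fin m → Mat n) : (krausMap U 1).IsHermitian := by
  rw [krausMap_apply, Matrix.IsHermitian, Matrix.conjTranspose_sum]
  simp

theorem trace_krausMap_one (hU : IsOrthonormalBasis (commutant A) U) :
    (krausMap U 1).trace = dim (commutant A) := by
  have e : ∀ i, ((U i).conjTranspose * U i).trace = 1 := fun i =>
    (hU.orthonormal i i).trans (if_pos rfl)
  rw [krausMap_apply, Matrix.trace_sum, hU.dim_eq]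
  simp [e]

/-- The Kraus map of `A'` is the conditional expectation followed by multiplication by the central
element `∑ i, (U i)ᴴ (U i)` of `A`. -/
theorem krausMap_eq_mul_condExp (hU : IsOrthonormalBasis (commutant A) U) (X : Mat n) :
    krausMap U X = krausMap U 1 * condExp A X := by
  have hz := krausMap_mem hU 1
  have hE := condExp_spec A
  refine eq_of_orthogonal A (X := krausMap U X) (krausMap_mem hU X)
    (mul_mem hz (hE.map_mem X)) (fun a _ => ?_) fun a ha => ?_
  · rw [sub_self, hsInner, mul_zero, Matrix.trace_zero]
  · have ha' : star a ∈ A := star_mem ha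
    have h1 : hsInner a (krausMap U X) = (star a * krausMap U 1 * X).trace := by
      rw [hsInner, ← Matrix.star_eq_conjTranspose, ← krausMap_mul_left hU.mem ha',
        krausMap_apply, krausMap_apply, hU.sum_conjTranspose_mul_mul 1, Finset.mul_sum,
        Finset.sum_mul, Matrix.trace_sum, Matrix.trace_sum]
      refine Finset.sum_congr rfl fun i _ => ?_
      have h := mem_commutant_iff.mp (mul_mem (hU.mem i) (star_mem (hU.mem i))) (star a) ha'
      rw [Matrix.star_eq_conjTranspose (U i)] at h
      rw [mul_one, h, Matrix.trace_mul_comm]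
      simp only [mul_assoc]
    have h2 : hsInner a (krausMap U 1 * condExp A X) = (star a * krausMap U 1 * X).trace := by
      have ho := hE.orthogonal X (star (star a * krausMap U 1))
        (star_mem (mul_mem ha' hz))
      rw [hsInner, ← Matrix.star_eq_conjTranspose, star_star, mul_sub, Matrix.trace_sub] at ho
      rw [hsInner, ← Matrix.star_eq_conjTranspose, ← mul_assoc]
      exact (sub_eq_zero.mp ho).symm
    rw [hsInner_sub_right, h1, h2, sub_self]

/-- Comparing the superoperator trace of `X ↦ ∑ i, (U i)ᴴ c X (U i)` computed from its Kraus form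
with the one computed from `krausMap_eq_mul_condExp`. -/
theorem trace_mul_krausMap_one_mul {k : ℕ} {V : Fin k → Mat n}
    (hU : IsOrthonormalBasis (commutant A) U) (hV : IsOrthonormalBasis A V)
    {c : Mat n} (hc : c ∈ A) (hc' : c ∈ commutant A) :
    (c * krausMap U 1 * ∑ j, V j * (V j).conjTranspose).trace = c.trace := by
  rw [← trace_mulLeft_comp_condExp hV]
  have h : LinearMap.mulLeft ℂ (c * krausMap U 1) ∘ₗ condExp A =
      ∑ i, LinearMap.mulLeft ℂ ((U i).conjTranspose * c) ∘ₗ LinearMap.mulRight ℂ (U i) := by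
    refine LinearMap.ext fun X => ?_
    simp only [LinearMap.comp_apply, LinearMap.mulLeft_apply, LinearMap.mulRight_apply,
      LinearMap.sum_apply]
    rw [mul_assoc, ← krausMap_eq_mul_condExp hU, ← krausMap_mul_left hU.mem hc, krausMap_apply]
    simp only [mul_assoc]
  rw [h, map_sum]
  simp only [trace_mulLeft_comp_mulRight]
  have h2 := congrArg Matrix.trace (hU.sum_hsInner_smul hc')
  rw [Matrix.trace_sum] at h2
  simpa only [Matrix.trace_smul, smul_eq_mul, hsInner] using h2

/-- With `z = ∑ i, (U i)ᴴ (U i)`, `w = ∑ j, (V j) (V j)ᴴ` and a real `s`, the sum of the squared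
norms of `(V j)ᴴ (z - s)` is `Tr z - 2 s n + s² Tr w`. -/
theorem sum_hsInner_mul_krausMap_one_sub {k : ℕ} {V : Fin k → Mat n}
    (hU : IsOrthonormalBasis (commutant A) U) (hV : IsOrthonormalBasis A V) (s : ℝ) :
    ∑ j, hsInner ((V j).conjTranspose * (krausMap U 1 - (s : ℂ) • 1))
        ((V j).conjTranspose * (krausMap U 1 - (s : ℂ) • 1)) =
      dim (commutant A) - 2 * s * n + s ^ 2 * dim A := by
  set z := krausMap U 1 with hz
  have hzA : z ∈ A := krausMap_mem hU 1
  have hzA' : z ∈ commutant A := krausMap_one_mem_commutant hU.mem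
  have hzz := trace_mul_krausMap_one_mul hU hV hzA hzA'
  have hz1 := trace_mul_krausMap_one_mul hU hV (one_mem A) (one_mem _)
  have hzh : z.conjTranspose = z := krausMap_one_isHermitian U
  have hw : (∑ j, V j * (V j).conjTranspose).trace = dim A := by
    have e : ∀ j, (V j * (V j).conjTranspose).trace = 1 := fun j => by
      rw [Matrix.trace_mul_comm]
      exact (hV.orthonormal j j).trans (if_pos rfl)
    rw [Matrix.trace_sum, hV.dim_eq]
    simp [e]
  rw [trace_krausMap_one hU] at hzz
  rw [one_mul, Matrix.trace_one, Fintype.card_fin] at hz1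
  have hd : (z - (s : ℂ) • (1 : Mat n)).conjTranspose = z - (s : ℂ) • 1 := by
    rw [Matrix.conjTranspose_sub, hzh, Matrix.conjTranspose_smul, Matrix.conjTranspose_one,
      Complex.star_def, Complex.conj_ofReal]
  have h : ∀ j, hsInner ((V j).conjTranspose * (z - (s : ℂ) • 1))
      ((V j).conjTranspose * (z - (s : ℂ) • 1)) =
      ((z - (s : ℂ) • 1) * (z - (s : ℂ) • 1) * (V j * (V j).conjTranspose)).trace := by
    intro j
    rw [hsInner, Matrix.conjTranspose_mul, Matrix.conjTranspose_conjTranspose, hd,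
      mul_assoc (z - (s : ℂ) • 1) (z - (s : ℂ) • 1), Matrix.trace_mul_comm (z - (s : ℂ) • 1)]
    simp only [mul_assoc]
  simp only [h]
  rw [← Matrix.trace_sum, ← Finset.mul_sum]
  set w := ∑ j, V j * (V j).conjTranspose
  have e : (z - (s : ℂ) • 1) * (z - (s : ℂ) • 1) * w =
      z * z * w - (2 * s : ℂ) • (z * w) + (s ^ 2 : ℂ) • w := by
    simp only [sub_mul, mul_sub, Matrix.smul_mul, Matrix.mul_smul, one_mul, mul_one]
    module
  rw [e, Matrix.trace_add, Matrix.trace_sub, Matrix.trace_smul, Matrix.trace_smul, hzz, hz1, hw,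
    smul_eq_mul, smul_eq_mul]

end Commutant

theorem dim_pos (hn : 1 ≤ n) (A : StarSubalgebra ℂ (Mat n)) : 0 < dim A := by
  obtain ⟨m, U, hU, i, -⟩ := exists_isOrthonormalBasis hn A
  rw [hU.dim_eq]
  exact i.pos

/-- In block form `A = ⨁ M_{k_i} ⊗ I_{m_i}` this is the Cauchy–Schwarz inequality
`(∑ k_i m_i)² ≤ ∑ k_i² ∑ m_i²`. -/
theorem sq_le_dim_mul_dim_commutant (hn : 1 ≤ n) (A : StarSubalgebra ℂ (Mat n)) :
    n ^ 2 ≤ dim A * dim (commutant A) := by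
  obtain ⟨m, V, hV, -⟩ := exists_isOrthonormalBasis hn A
  obtain ⟨m', U, hU, -⟩ := exists_isOrthonormalBasis hn (commutant A)
  have hd : (0 : ℝ) < dim A := by exact_mod_cast dim_pos hn A
  -- `s = n / Tr w` minimises the quadratic polynomial in `s`.
  have h := sum_hsInner_mul_krausMap_one_sub hU hV ((n : ℝ) / dim A)
  have h0 : (0 : ℂ) ≤ ((dim (commutant A) - 2 * (n / dim A) * n + (n / dim A) ^ 2 * dim A : ℝ) : ℂ)
      := by
    push_cast at h ⊢
    rw [← h]
    exact Finset.sum_nonneg fun j _ => hsInner_self_nonneg _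
  rw [Complex.zero_le_real] at h0
  have e : (dim (commutant A) - 2 * (n / dim A) * n + (n / dim A) ^ 2 * dim A : ℝ) =
      (dim A * dim (commutant A) - n ^ 2) / dim A := by
    field_simp
    ring
  rw [e, le_div_iff₀ hd, zero_mul, sub_nonneg] at h0
  exact_mod_cast h0

/-- The equality case of `sq_le_dim_mul_dim_commutant`. -/
theorem krausMap_one_of_dim_mul_dim_commutant (hn : 1 ≤ n) {A : StarSubalgebra ℂ (Mat n)}
    (hA : dim A * dim (commutant A) = n ^ 2) {U : Fin m → Mat n}
    (hU : IsOrthonormalBasis (commutant A) U) :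
    krausMap U 1 = ((dim (commutant A) : ℂ) / n) • 1 := by
  obtain ⟨k, V, hV, -⟩ := exists_isOrthonormalBasis hn A
  have hn0 : (n : ℂ) ≠ 0 := by exact_mod_cast (by omega : n ≠ 0)
  have hAc : (dim A : ℂ) * dim (commutant A) = n ^ 2 := by exact_mod_cast hA
  have h := sum_hsInner_mul_krausMap_one_sub hU hV ((dim (commutant A) : ℝ) / n)
  push_cast at h
  have e : (dim (commutant A) - 2 * (dim (commutant A) / n) * n +
      (dim (commutant A) / n) ^ 2 * dim A : ℂ) = 0 := by
    field_simp
    linear_combination (dim (commutant A) : ℂ) * hAc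
  rw [e, Finset.sum_eq_zero_iff_of_nonneg fun j _ => hsInner_self_nonneg _] at h
  have h1 := congrArg Matrix.conjTranspose (hV.sum_hsInner_smul (one_mem A))
  rw [Matrix.conjTranspose_one, Matrix.conjTranspose_sum] at h1
  rw [← sub_eq_zero]
  generalize krausMap U 1 - ((dim (commutant A) : ℂ) / n) • 1 = d at h ⊢
  rw [← one_mul d, ← h1, Finset.sum_mul]
  refine Finset.sum_eq_zero fun j _ => ?_
  rw [Matrix.conjTranspose_smul, Matrix.smul_mul,
    hsInner_self_eq_zero.mp (h j (Finset.mem_univ j)), smul_zero]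

theorem condExp_eq_of_dim_mul_dim_commutant (hn : 1 ≤ n) {A : StarSubalgebra ℂ (Mat n)}
    (hA : dim A * dim (commutant A) = n ^ 2) {U : Fin m → Mat n}
    (hU : IsOrthonormalBasis (commutant A) U) (X : Mat n) :
    condExp A X = ((n : ℂ) / dim (commutant A)) • ∑ i, (U i).conjTranspose * X * U i := by
  have hn0 : (n : ℂ) ≠ 0 := by exact_mod_cast (by omega : n ≠ 0)
  have hd : (dim (commutant A) : ℂ) ≠ 0 := by exact_mod_cast (dim_pos hn (commutant A)).ne'
  rw [← krausMap_apply, krausMap_eq_mul_condExp hU, krausMap_one_of_dim_mul_dim_commutant hn hA hU,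
    Matrix.smul_mul, one_mul, smul_smul]
  rw [div_mul_div_cancel₀ hd, div_self hn0, one_smul]

/-! ### Complementary subalgebras -/

theorem Complementary.trace_mul {A B : StarSubalgebra ℂ (Mat n)} (h : Complementary A B)
    (hn : 1 ≤ n) {a b : Mat n} (ha : a ∈ A) (hb : b ∈ B) :
    n * (a * b).trace = a.trace * b.trace := by
  have hn0 : (n : ℂ) ≠ 0 := by exact_mod_cast (by omega : n ≠ 0)
  have ht : ∀ c : Mat n, hsInner 1 (c - (c.trace / n) • 1) = 0 := fun c => by
    rw [hsInner_sub_right, hsInner_smul_right, hsInner_one_one, hsInner_one_left,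
      div_mul_cancel₀ _ hn0, sub_self]
  have h1 := h (star a - ((star a).trace / n) • 1)
    (sub_mem (star_mem ha) (A.smul_mem (one_mem A) _))
    (b - (b.trace / n) • 1) (sub_mem hb (B.smul_mem (one_mem B) _)) (ht _) (ht _)
  have h2 : (star a - ((star a).trace / n) • (1 : Mat n)).conjTranspose =
      a - (a.trace / n) • 1 := by
    rw [Matrix.conjTranspose_sub, Matrix.conjTranspose_smul, Matrix.conjTranspose_one,
      Matrix.star_eq_conjTranspose, Matrix.conjTranspose_conjTranspose,
      Matrix.trace_conjTranspose, star_div₀, star_star, Complex.star_def, Complex.conj_natCast]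
  rw [hsInner, h2] at h1
  simp only [sub_mul, mul_sub, Matrix.smul_mul, Matrix.mul_smul, one_mul, mul_one,
    Matrix.trace_sub, Matrix.trace_smul, Matrix.trace_one, Fintype.card_fin, smul_eq_mul] at h1
  field_simp at h1
  linear_combination h1

/-- For complementary subalgebras the products of the members of two orthonormal bases are
pairwise orthogonal and nonzero. -/
theorem Complementary.dim_mul_dim_le {A B : StarSubalgebra ℂ (Mat n)} (h : Complementary A B)
    (hn : 1 ≤ n) : dim A * dim B ≤ n ^ 2 := by
  obtain ⟨k, V, hV, -⟩ := exists_isOrthonormalBasis hn A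
  obtain ⟨l, W, hW, -⟩ := exists_isOrthonormalBasis hn B
  have hn0 : (n : ℂ) ≠ 0 := by exact_mod_cast (by omega : n ≠ 0)
  have hli : LinearIndependent ℂ fun p : Fin k × Fin l => V p.1 * W p.2 := by
    refine linearIndependent_of_hsInner (c := 1 / n) (one_div_ne_zero hn0) fun p q => ?_
    have e : hsInner (V p.1 * W p.2) (V q.1 * W q.2) =
        ((V p.1).conjTranspose * V q.1 * (W q.2 * (W p.2).conjTranspose)).trace := by
      rw [hsInner, Matrix.conjTranspose_mul, mul_assoc, Matrix.trace_mul_comm]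
      simp only [mul_assoc]
    have h1 := h.trace_mul hn (mul_mem (star_mem (hV.mem p.1)) (hV.mem q.1))
      (mul_mem (hW.mem q.2) (star_mem (hW.mem p.2)))
    have h2 := hV.orthonormal p.1 q.1
    have h3 := hW.orthonormal p.2 q.2
    rw [hsInner] at h2 h3
    rw [Matrix.trace_mul_comm] at h3
    simp only [Matrix.star_eq_conjTranspose] at h1
    rw [h2, h3, ← e] at h1
    rw [eq_div_of_mul_eq hn0 ((mul_comm _ _).trans h1)]
    by_cases hp : p.1 = q.1 <;> by_cases hq : p.2 = q.2 <;> simp [Prod.ext_iff, hp, hq]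
  have hle := hli.fintype_card_le_finrank
  rw [Fintype.card_prod, Fintype.card_fin, Fintype.card_fin, Module.finrank_matrix,
    Fintype.card_fin, Module.finrank_self, mul_one, ← sq] at hle
  rwa [hV.dim_eq, hW.dim_eq]

theorem dim_mul_eq_of_complementary (hn : 1 ≤ n) {A B : StarSubalgebra ℂ (Mat n)}
    (h : Complementary A B) (h' : Complementary (commutant A) (commutant B)) :
    dim A * dim (commutant A) = n ^ 2 ∧ dim A * dim B = n ^ 2 := by
  have h1 := h.dim_mul_dim_le hn
  have h2 := h'.dim_mul_dim_le hn
  have h3 := sq_le_dim_mul_dim_commutant hn A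
  have h4 := sq_le_dim_mul_dim_commutant hn B
  have hN : 0 < n ^ 2 := by positivity
  generalize n ^ 2 = N at *
  have h5 : dim A * dim (commutant A) * (dim B * dim (commutant B)) ≤ N * N := by
    calc _ = dim A * dim B * (dim (commutant A) * dim (commutant B)) := by ring
      _ ≤ N * N := Nat.mul_le_mul h1 h2
  constructor
  · nlinarith
  · have h6 : N * N ≤ dim A * dim B * (dim (commutant A) * dim (commutant B)) := by
      calc N * N ≤ dim A * dim (commutant A) * (dim B * dim (commutant B)) := Nat.mul_le_mul h3 h4
        _ = _ := by ring
    exact le_antisymm h1 (Nat.le_of_mul_le_mul_right (h6.trans (Nat.mul_le_mul_left _ h2)) hN)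

/-! ### Complete positivity -/

theorem IsCompletelyPositive.add {Φ Ψ : Mat n →ₗ[ℂ] Mat n} (hΦ : IsCompletelyPositive Φ)
    (hΨ : IsCompletelyPositive Ψ) : IsCompletelyPositive (Φ + Ψ) :=
  fun k M hM => (hΦ k M hM).add (hΨ k M hM)

theorem IsCompletelyPositive.smul {Φ : Mat n →ₗ[ℂ] Mat n} (hΦ : IsCompletelyPositive Φ) {c : ℂ}
    (hc : 0 ≤ c) : IsCompletelyPositive (c • Φ) :=
  fun k M hM => (hΦ k M hM).smul hc

theorem isCompletelyPositive_zero : IsCompletelyPositive (0 : Mat n →ₗ[ℂ] Mat n) :=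
  fun _ _ _ => Matrix.PosSemidef.zero

theorem isCompletelyPositive_sum {ι : Type*} (s : Finset ι) {F : ι → Mat n →ₗ[ℂ] Mat n}
    (hF : ∀ i ∈ s, IsCompletelyPositive (F i)) : IsCompletelyPositive (∑ i ∈ s, F i) :=
  Finset.sum_induction F IsCompletelyPositive (fun _ _ h h' => h.add h')
    isCompletelyPositive_zero hF

theorem isCompletelyPositive_id : IsCompletelyPositive (LinearMap.id : Mat n →ₗ[ℂ] Mat n) :=
  fun _ _ hM => hM

theorem isCompletelyPositive_mulLeft_comp_mulRight (W : Mat n) :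
    IsCompletelyPositive (LinearMap.mulLeft ℂ W.conjTranspose ∘ₗ LinearMap.mulRight ℂ W) := by
  intro k M hM
  have h := hM.conjTranspose_mul_mul_same
    (Matrix.kroneckerMap (· * ·) (1 : Matrix (Fin k) (Fin k) ℂ) W)
  convert h using 1
  ext ⟨p, a⟩ ⟨q, b⟩
  simp [ampliation, Matrix.mul_apply, Fintype.sum_prod_type, Matrix.one_apply, Finset.mul_sum,
    Finset.sum_mul]
  rw [Finset.sum_comm]
  refine Finset.sum_congr rfl fun d _ => ?_
  rw [Finset.sum_eq_single p (fun c _ hc => by simp [hc]) (fun h => absurd (Finset.mem_univ p) h)]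
  simp [mul_assoc]

/-- The value at the vector of conjugated entries of `Z` of the quadratic form of the Choi matrix
`∑ p q, single p q 1 ⊗ Φ (single p q 1)`, written as the trace of the superoperator
`X ↦ Z Φ(X) Zᴴ`. -/
def choiForm (Z : Mat n) (Φ : Mat n →ₗ[ℂ] Mat n) : ℂ :=
  LinearMap.trace ℂ (Mat n)
    ((LinearMap.mulLeft ℂ Z ∘ₗ LinearMap.mulRight ℂ Z.conjTranspose) ∘ₗ Φ)

theorem IsCompletelyPositive.choiForm_nonneg {Φ : Mat n →ₗ[ℂ] Mat n} (hΦ : IsCompletelyPositive Φ)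
    (Z : Mat n) : 0 ≤ choiForm Z Φ := by
  have h := (hΦ n _ (Matrix.posSemidef_vecMulVec_self_star
    fun p : Fin n × Fin n => if p.1 = p.2 then (1 : ℂ) else 0)).dotProduct_mulVec_nonneg
    fun p => star (Z p.1 p.2)
  convert h using 1
  have e : ∀ p q : Fin n, (Matrix.of fun a b => Matrix.vecMulVec
      (fun p : Fin n × Fin n => if p.1 = p.2 then (1 : ℂ) else 0)
      (star fun p : Fin n × Fin n => if p.1 = p.2 then (1 : ℂ) else 0) (p, a) (q, b)) =
      Matrix.single p q (1 : ℂ) := by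
    intro p q
    ext a b
    simp only [Matrix.of_apply, Matrix.vecMulVec_apply, Pi.star_apply, Matrix.single_apply]
    by_cases hp : p = a <;> by_cases hq : q = b <;> simp [hp, hq]
  rw [choiForm, trace_eq_sum_single]
  simp only [dotProduct, Matrix.mulVec, ampliation, Matrix.of_apply, e, Pi.star_apply, star_star,
    Fintype.sum_prod_type, LinearMap.comp_apply, LinearMap.mulLeft_apply,
    LinearMap.mulRight_apply, Matrix.mul_apply, Matrix.conjTranspose_apply, Finset.mul_sum]
  refine Finset.sum_congr rfl fun p _ => ?_
  rw [Finset.sum_comm]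

theorem choiForm_add (Z : Mat n) (Φ Ψ : Mat n →ₗ[ℂ] Mat n) :
    choiForm Z (Φ + Ψ) = choiForm Z Φ + choiForm Z Ψ := by
  rw [choiForm, LinearMap.comp_add, map_add]; rfl

theorem choiForm_smul (Z : Mat n) (c : ℂ) (Φ : Mat n →ₗ[ℂ] Mat n) :
    choiForm Z (c • Φ) = c * choiForm Z Φ := by
  rw [choiForm, LinearMap.comp_smul, map_smul]; rfl

theorem choiForm_sum {ι : Type*} (s : Finset ι) (Z : Mat n) (F : ι → Mat n →ₗ[ℂ] Mat n) :
    choiForm Z (∑ i ∈ s, F i) = ∑ i ∈ s, choiForm Z (F i) := by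
  induction s using Finset.cons_induction with
  | empty => simp [choiForm]
  | cons i s hi ih => rw [Finset.sum_cons, Finset.sum_cons, choiForm_add, ih]

theorem choiForm_trace (Z : Mat n) :
    choiForm Z ((Matrix.traceLinearMap (Fin n) ℂ ℂ).smulRight (1 : Mat n)) =
      (Z * Z.conjTranspose).trace := by
  have h : (LinearMap.mulLeft ℂ Z ∘ₗ LinearMap.mulRight ℂ Z.conjTranspose) ∘ₗ
      (Matrix.traceLinearMap (Fin n) ℂ ℂ).smulRight (1 : Mat n) =
      (Matrix.traceLinearMap (Fin n) ℂ ℂ).smulRight (Z * Z.conjTranspose) := by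
    refine LinearMap.ext fun X => ?_
    simp only [LinearMap.comp_apply, LinearMap.smulRight_apply, map_smul,
      LinearMap.mulLeft_apply, LinearMap.mulRight_apply, one_mul]
  rw [choiForm, h, LinearMap.trace_smulRight, Matrix.traceLinearMap_apply]

theorem choiForm_krausMap (Z : Mat n) (U : Fin m → Mat n) :
    choiForm Z (krausMap U) = ∑ i, hsInner (U i) Z * (U i * Z.conjTranspose).trace := by
  rw [krausMap, choiForm_sum]
  refine Finset.sum_congr rfl fun i _ => ?_
  have h : (LinearMap.mulLeft ℂ Z ∘ₗ LinearMap.mulRight ℂ Z.conjTranspose) ∘ₗ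
      (LinearMap.mulLeft ℂ (U i).conjTranspose ∘ₗ LinearMap.mulRight ℂ (U i)) =
      LinearMap.mulLeft ℂ (Z * (U i).conjTranspose) ∘ₗ
        LinearMap.mulRight ℂ (U i * Z.conjTranspose) := by
    refine LinearMap.ext fun X => ?_
    simp only [LinearMap.comp_apply, LinearMap.mulLeft_apply, LinearMap.mulRight_apply, mul_assoc]
  rw [choiForm, h, trace_mulLeft_comp_mulRight, hsInner, Matrix.trace_mul_comm Z]

theorem choiForm_krausMap_of_mem {A : StarSubalgebra ℂ (Mat n)} {U : Fin m → Mat n}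
    (hU : IsOrthonormalBasis A U) {Z : Mat n} (hZ : Z ∈ A) :
    choiForm Z (krausMap U) = (Z * Z.conjTranspose).trace := by
  rw [choiForm_krausMap]
  conv_rhs =>
    enter [1, 1]
    rw [← hU.sum_hsInner_smul hZ]
  rw [Finset.sum_mul, Matrix.trace_sum]
  simp only [Matrix.smul_mul, Matrix.trace_smul, smul_eq_mul]

/-! ### Complementary subalgebras that span `M_n` -/

theorem condExp_of_mem_complementary (hn : 1 ≤ n) {A B : StarSubalgebra ℂ (Mat n)}
    (h : Complementary A B) {X : Mat n} (hX : X ∈ B) :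
    condExp A X = (X.trace / n) • 1 := by
  have hn0 : (n : ℂ) ≠ 0 := by exact_mod_cast (by omega : n ≠ 0)
  have hE := condExp_spec A
  refine eq_of_orthogonal A (hE.map_mem X) (A.smul_mem (one_mem A) _) (hE.orthogonal X)
    fun a ha => ?_
  have ht := h.trace_mul hn (star_mem ha) hX
  rw [hsInner_sub_right, hsInner_smul_right, hsInner, hsInner, mul_one,
    ← Matrix.star_eq_conjTranspose]
  field_simp
  linear_combination ht

section Family

variable {r : ℕ} {A : Fin r → StarSubalgebra ℂ (Mat n)}

/-- `M_n` is the orthogonal sum of `ℂ I` and the subspaces `A_j ⊖ ℂ I`. -/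
theorem id_eq_sum_condExp (hn : 1 ≤ n) (hA : ∀ i j, i ≠ j → Complementary (A i) (A j))
    (hspan : Submodule.span ℂ (⋃ j, (A j : Set (Mat n))) = ⊤) :
    (LinearMap.id : Mat n →ₗ[ℂ] Mat n) =
      (1 / n : ℂ) • (Matrix.traceLinearMap (Fin n) ℂ ℂ).smulRight (1 : Mat n) +
      ∑ j, (condExp (A j) -
        (1 / n : ℂ) • (Matrix.traceLinearMap (Fin n) ℂ ℂ).smulRight (1 : Mat n)) := by
  refine LinearMap.ext_on hspan fun X hX => ?_
  obtain ⟨i, hi⟩ := Set.mem_iUnion.mp hX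
  simp only [LinearMap.add_apply, LinearMap.sum_apply, LinearMap.sub_apply, LinearMap.smul_apply,
    LinearMap.smulRight_apply, Matrix.traceLinearMap_apply, LinearMap.id_apply]
  rw [Finset.sum_eq_single i, (condExp_spec (A i)).map_of_mem X hi, add_sub_cancel]
  · intro j _ hj
    rw [condExp_of_mem_complementary hn (hA j i hj) hi, smul_smul, one_div_mul_eq_div, sub_self]
  · exact fun h => absurd (Finset.mem_univ i) h

theorem sum_dim_sub_one (hn : 1 ≤ n) (hA : ∀ i j, i ≠ j → Complementary (A i) (A j))
    (hspan : Submodule.span ℂ (⋃ j, (A j : Set (Mat n))) = ⊤) :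
    ∑ j, ((dim (A j) : ℤ) - 1) = (n : ℤ) ^ 2 - 1 := by
  have hn0 : (n : ℂ) ≠ 0 := by exact_mod_cast (by omega : n ≠ 0)
  have h := congrArg (LinearMap.trace ℂ (Mat n)) (id_eq_sum_condExp hn hA hspan)
  simp only [LinearMap.trace_id, map_add, map_sum, map_sub, map_smul, LinearMap.trace_smulRight,
    Matrix.traceLinearMap_apply, Matrix.trace_one, Fintype.card_fin, trace_condExp hn,
    Module.finrank_matrix, Module.finrank_self, smul_eq_mul, one_div_mul_cancel hn0] at h
  have h2 : (∑ j, ((dim (A j) : ℤ) - 1) : ℂ) = (n : ℂ) ^ 2 - 1 := by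
    push_cast at h ⊢
    linear_combination -h
  exact_mod_cast h2

theorem dim_ne_of_ne_top {A : StarSubalgebra ℂ (Mat n)} (hA : A ≠ ⊤) : dim A ≠ n ^ 2 := by
  intro h
  refine hA (StarSubalgebra.toSubalgebra_injective
    (Subalgebra.toSubmodule_injective (Submodule.eq_top_of_finrank_eq ?_)))
  rw [Module.finrank_matrix, Fintype.card_fin, Module.finrank_self, mul_one, ← sq]
  exact h

theorem dim_eq_of_span_eq_top (hn : 1 ≤ n) (hr : 2 ≤ r)
    (hA : ∀ i j, i ≠ j → Complementary (A i) (A j))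
    (hA' : ∀ i j, i ≠ j → Complementary (commutant (A i)) (commutant (A j)))
    (htop : ∀ j, A j ≠ ⊤) (hspan : Submodule.span ℂ (⋃ j, (A j : Set (Mat n))) = ⊤) (i : Fin r) :
    dim (A i) = n := by
  have : Nontrivial (Fin r) := Fin.nontrivial_iff_two_le.mpr hr
  obtain ⟨j, hj⟩ := exists_ne i
  have hij := (dim_mul_eq_of_complementary hn (hA i j hj.symm) (hA' i j hj.symm)).2
  by_cases hk : ∃ k, k ≠ i ∧ k ≠ j
  · obtain ⟨k, hki, hkj⟩ := hk
    have hik := (dim_mul_eq_of_complementary hn (hA i k hki.symm) (hA' i k hki.symm)).2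
    have hjk := (dim_mul_eq_of_complementary hn (hA j k hkj.symm) (hA' j k hkj.symm)).2
    have h1 := Nat.eq_of_mul_eq_mul_left (dim_pos hn (A i)) (hij.trans hik.symm)
    rw [← hij, h1] at hjk
    have h2 := Nat.eq_of_mul_eq_mul_right (dim_pos hn (A k)) hjk
    rw [h1, h2, ← sq] at hij
    exact Nat.pow_left_injective two_ne_zero hij
  · -- With two subalgebras only, `(dim (A i) - 1) (dim (A j) - 1) = 0`, so one of them is `M_n`.
    exfalso
    push Not at hk
    have huniv : (Finset.univ : Finset (Fin r)) = {i, j} := by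
      ext k
      have := hk k
      simp only [Finset.mem_univ, Finset.mem_insert, Finset.mem_singleton, true_iff]
      tauto
    have hs := sum_dim_sub_one hn hA hspan
    rw [huniv, Finset.sum_pair hj.symm] at hs
    have hz : (dim (A i) : ℤ) * dim (A j) = n ^ 2 := by exact_mod_cast hij
    have hp : ((dim (A i) : ℤ) - 1) * (dim (A j) - 1) = 0 := by linear_combination hz - hs
    rcases mul_eq_zero.mp hp with h | h
    · have h1 : dim (A i) = 1 := by omega
      rw [h1, one_mul] at hij
      exact dim_ne_of_ne_top (htop j) hij
    · have h1 : dim (A j) = 1 := by omega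
      rw [h1, mul_one] at hij
      exact dim_ne_of_ne_top (htop i) hij

theorem condExp_eq_krausMap (hn : 1 ≤ n) {B : StarSubalgebra ℂ (Mat n)} (hB : dim B = n)
    (hB' : dim (commutant B) = n) {U : Fin m → Mat n}
    (hU : IsOrthonormalBasis (commutant B) U) : condExp B = krausMap U := by
  have hn0 : (n : ℂ) ≠ 0 := by exact_mod_cast (by omega : n ≠ 0)
  refine LinearMap.ext fun X => ?_
  rw [condExp_eq_of_dim_mul_dim_commutant hn (by rw [hB, hB', sq]) hU, hB', div_self hn0, one_smul,
    krausMap_apply]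

theorem isCompletelyPositive_condExp_sub_id (hn : 1 ≤ n) {B : StarSubalgebra ℂ (Mat n)}
    (hB : dim B = n) (hB' : dim (commutant B) = n) :
    IsCompletelyPositive (condExp B - (1 / n : ℂ) • LinearMap.id) := by
  obtain ⟨m, U, hU, i, hi⟩ := exists_isOrthonormalBasis hn (commutant B)
  have h : condExp B - (1 / n : ℂ) • LinearMap.id = ∑ k ∈ Finset.univ.erase i,
      LinearMap.mulLeft ℂ (U k).conjTranspose ∘ₗ LinearMap.mulRight ℂ (U k) := by
    rw [condExp_eq_krausMap hn hB hB' hU, krausMap, ← Finset.add_sum_erase _ _ (Finset.mem_univ i),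
      add_sub_right_comm, add_eq_right, sub_eq_zero]
    refine LinearMap.ext fun X => ?_
    have hs : ((1 / Real.sqrt n : ℝ) : ℂ) * ((1 / Real.sqrt n : ℝ) : ℂ) = 1 / n := by
      rw [← Complex.ofReal_mul, div_mul_div_comm, Real.mul_self_sqrt (Nat.cast_nonneg n)]
      push_cast
      rw [one_mul]
    simp only [LinearMap.comp_apply, LinearMap.mulLeft_apply, LinearMap.mulRight_apply, hi,
      Matrix.conjTranspose_smul, Matrix.conjTranspose_one, Complex.star_def, Complex.conj_ofReal,
      Matrix.smul_mul, Matrix.mul_smul, one_mul, mul_one, smul_smul, hs, LinearMap.smul_apply,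
      LinearMap.id_apply]
  rw [h]
  exact isCompletelyPositive_sum _ fun k _ => isCompletelyPositive_mulLeft_comp_mulRight _

/-- The identity `Tr(X) I = X / n + ∑ i, (E_i(X) - X / n)` turns the channel into a combination of
completely positive maps. -/
theorem pauliChannel_eq (hn : 1 ≤ n) (hA : ∀ i j, i ≠ j → Complementary (A i) (A j))
    (hspan : Submodule.span ℂ (⋃ j, (A j : Set (Mat n))) = ⊤) (hrn : r = n + 1)
    (lam : Fin r → ℝ) :
    pauliChannel A lam = (((1 + (n - 1) * ∑ j, lam j) / n ^ 2 : ℝ) : ℂ) • LinearMap.id +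
      ∑ i, (((1 - ∑ j, lam j) / n + lam i : ℝ) : ℂ) •
        (condExp (A i) - (1 / n : ℂ) • LinearMap.id) := by
  have hn0 : (n : ℂ) ≠ 0 := by exact_mod_cast (by omega : n ≠ 0)
  have h := id_eq_sum_condExp hn hA hspan
  have hrc : (r : ℂ) = n + 1 := by rw [hrn]; push_cast; rfl
  rw [Finset.sum_sub_distrib, Finset.sum_const, Finset.card_univ, Fintype.card_fin,
    ← Nat.cast_smul_eq_nsmul ℂ, hrc] at h
  rw [pauliChannel]
  generalize (Matrix.traceLinearMap (Fin n) ℂ ℂ).smulRight (1 : Mat n) = T at h ⊢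
  push_cast
  simp only [smul_sub, add_smul, Finset.sum_sub_distrib, Finset.sum_add_distrib,
    ← Finset.smul_sum, Finset.sum_const, Finset.card_univ, Fintype.card_fin, ← Finset.sum_smul,
    ← Nat.cast_smul_eq_nsmul ℂ, hrc]
  generalize ∑ j, condExp (A j) = S at h ⊢
  generalize ∑ j, (lam j : ℂ) • condExp (A j) = R
  generalize ∑ j, (lam j : ℂ) = L
  have hT : T = S - LinearMap.id := by
    rw [h]
    match_scalars <;> (field_simp; ring)
  rw [hT]
  match_scalars <;> field_simp <;> ring

theorem isCompletelyPositive_pauliChannel_iff (hn : 2 ≤ n)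
    (hA : ∀ i j, i ≠ j → Complementary (A i) (A j))
    (hA' : ∀ i j, i ≠ j → Complementary (commutant (A i)) (commutant (A j)))
    (hspan : Submodule.span ℂ (⋃ j, (A j : Set (Mat n))) = ⊤) (hrn : r = n + 1)
    (hd : ∀ i, dim (A i) = n) (hd' : ∀ i, dim (commutant (A i)) = n) (lam : Fin r → ℝ) :
    IsCompletelyPositive (pauliChannel A lam) ↔
      (∀ i, 0 ≤ (1 - ∑ j, lam j) / n + lam i) ∧ 0 ≤ (1 + (n - 1) * ∑ j, lam j) / (n : ℝ) ^ 2 := by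
  have hn1 : 1 ≤ n := by omega
  have hn0 : (n : ℂ) ≠ 0 := by exact_mod_cast (by omega : n ≠ 0)
  constructor
  · intro h
    choose m U hU i₀ hi₀ using fun i => exists_isOrthonormalBasis hn1 (commutant (A i))
    have hform : ∀ Z, choiForm Z (pauliChannel A lam) = (1 - ∑ i, (lam i : ℂ)) / n *
        (Z * Z.conjTranspose).trace + ∑ i, (lam i : ℂ) * choiForm Z (krausMap (U i)) := by
      intro Z
      rw [pauliChannel, choiForm_add, choiForm_smul, choiForm_trace, choiForm_sum]
      simp only [choiForm_smul, condExp_eq_krausMap hn1 (hd _) (hd' _) (hU _)]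
    constructor
    · intro i
      have hm : m i = n := (hU i).dim_eq.symm.trans (hd' i)
      have : Nontrivial (Fin (m i)) := Fin.nontrivial_iff_two_le.mpr (hm ▸ hn)
      obtain ⟨k, hk⟩ := exists_ne (i₀ i)
      -- The test vector is an element of `A_i' ⊖ ℂ I`.
      set Z := U i k with hZ
      have hZ0 : Z.trace = 0 := by
        have h1 := (hU i).orthonormal k (i₀ i)
        rw [if_neg hk, hi₀, hsInner_smul_right, ← star_hsInner, hsInner_one_left] at h1
        have h2 : ((1 / Real.sqrt n : ℝ) : ℂ) ≠ 0 := by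
          have : (0 : ℝ) < n := by exact_mod_cast hn1
          exact_mod_cast (by positivity : 1 / Real.sqrt n ≠ 0)
        exact star_eq_zero.mp ((mul_eq_zero.mp h1).resolve_left h2)
      have hZ1 : (Z * Z.conjTranspose).trace = 1 := by
        rw [Matrix.trace_mul_comm]
        exact ((hU i).orthonormal k k).trans (if_pos rfl)
      have hZf := h.choiForm_nonneg Z
      have hs : ∑ j, (lam j : ℂ) * choiForm Z (krausMap (U j)) =
          lam i * choiForm Z (krausMap (U i)) := by
        refine Finset.sum_eq_single i (fun j _ hj => ?_) fun hi => absurd (Finset.mem_univ i) hi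
        rw [choiForm_krausMap, Finset.sum_eq_zero, mul_zero]
        intro l _
        have ht := (hA' j i hj).trace_mul hn1 (star_mem ((hU j).mem l)) ((hU i).mem k)
        rw [← hZ, hZ0, mul_zero] at ht
        rw [hsInner, ← Matrix.star_eq_conjTranspose, (mul_eq_zero.mp ht).resolve_left hn0, zero_mul]
      rw [hform, hs, choiForm_krausMap_of_mem (hU i) ((hU i).mem k), hZ1] at hZf
      have e : (1 - ∑ i, (lam i : ℂ)) / n * 1 + lam i * 1 =
          (((1 - ∑ j, lam j) / n + lam i : ℝ) : ℂ) := by push_cast; ring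
      rwa [e, Complex.zero_le_real] at hZf
    · have h1 := h.choiForm_nonneg 1
      rw [hform] at h1
      simp only [choiForm_krausMap_of_mem (hU _) (one_mem _), Matrix.conjTranspose_one, mul_one,
        Matrix.trace_one, Fintype.card_fin, ← Finset.sum_mul, div_mul_cancel₀ _ hn0] at h1
      have e : 1 - ∑ i, (lam i : ℂ) + (∑ i, (lam i : ℂ)) * n =
          ((1 + (n - 1) * ∑ j, lam j : ℝ) : ℂ) := by push_cast; ring
      rw [e, Complex.zero_le_real] at h1
      exact div_nonneg h1 (sq_nonneg _)
  · rintro ⟨h1, h2⟩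
    rw [pauliChannel_eq hn1 hA hspan hrn]
    exact (isCompletelyPositive_id.smul (Complex.zero_le_real.mpr h2)).add
      (isCompletelyPositive_sum _ fun i _ =>
        (isCompletelyPositive_condExp_sub_id hn1 (hd i) (hd' i)).smul
          (Complex.zero_le_real.mpr (h1 i)))

end Family

end PauliChannel

end

theorem theorem2p4 (n r : ℕ) (hn : 1 ≤ n) (hr : 2 ≤ r)
    (A : Fin r → StarSubalgebra ℂ (PauliChannel.Mat n))
    (hA : ∀ i j, i ≠ j → PauliChannel.Complementary (A i) (A j))
    (hA' : ∀ i j, i ≠ j → PauliChannel.Complementary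
      (PauliChannel.commutant (A i)) (PauliChannel.commutant (A j))) :
    (∀ j,
      (∃ (m : ℕ) (U : Fin m → PauliChannel.Mat n),
        PauliChannel.IsOrthonormalBasis (PauliChannel.commutant (A j)) U ∧
        ∃ i, U i = ((1 / Real.sqrt n : ℝ) : ℂ) • (1 : PauliChannel.Mat n)) ∧
      (∀ (m : ℕ) (U : Fin m → PauliChannel.Mat n),
        PauliChannel.IsOrthonormalBasis (PauliChannel.commutant (A j)) U →
        ∀ X : PauliChannel.Mat n,
          PauliChannel.condExp (A j) X =
            ((n : ℂ) / (PauliChannel.dim (PauliChannel.commutant (A j)) : ℂ)) •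
              ∑ i, (U i).conjTranspose * X * U i)) ∧
    ((∀ j, A j ≠ ⊤) →
      Submodule.span ℂ (⋃ j, (A j : Set (PauliChannel.Mat n))) = ⊤ →
      ∀ lam : Fin r → ℝ,
        PauliChannel.IsCompletelyPositive (PauliChannel.pauliChannel A lam) ↔
          (∀ i, ∑ j, lam j ≤
            1 + (n : ℝ) ^ 2 * lam i / (PauliChannel.dim (PauliChannel.commutant (A i)) : ℝ)) ∧
          -1 ≤ ∑ j, lam j *
            ((n : ℝ) ^ 2 / (PauliChannel.dim (PauliChannel.commutant (A j)) : ℝ) - 1)) := by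
  open PauliChannel in
  have : Nontrivial (Fin r) := Fin.nontrivial_iff_two_le.mpr hr
  have hdim : ∀ j, dim (A j) * dim (commutant (A j)) = n ^ 2 := fun j => by
    obtain ⟨k, hk⟩ := exists_ne j
    exact (dim_mul_eq_of_complementary hn (hA j k hk.symm) (hA' j k hk.symm)).1
  refine ⟨fun j => ⟨exists_isOrthonormalBasis hn _, fun m U hU X =>
    condExp_eq_of_dim_mul_dim_commutant hn (hdim j) hU X⟩, fun htop hspan lam => ?_⟩
  have hd := dim_eq_of_span_eq_top hn hr hA hA' htop hspan
  have hd' : ∀ i, dim (commutant (A i)) = n := fun i => by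
    have h := hdim i
    rw [hd i, sq] at h
    exact Nat.eq_of_mul_eq_mul_left hn h
  have hn2 : 2 ≤ n := by
    by_contra hlt
    obtain rfl : n = 1 := by omega
    exact dim_ne_of_ne_top (htop ⟨0, by omega⟩) (by rw [hd, one_pow])
  have hrn : r = n + 1 := by
    have hs := sum_dim_sub_one hn hA hspan
    simp only [hd, Finset.sum_const, Finset.card_univ, Fintype.card_fin, nsmul_eq_mul] at hs
    have h0 : (n : ℤ) - 1 ≠ 0 := by omega
    have h1 : (r : ℤ) = n + 1 := mul_right_cancel₀ h0 (by linear_combination hs)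
    exact_mod_cast h1
  rw [isCompletelyPositive_pauliChannel_iff hn2 hA hA' hspan hrn hd hd']
  have hpos : (0 : ℝ) < n := by exact_mod_cast hn
  simp only [hd', ← Finset.sum_mul]
  generalize ∑ j, lam j = L
  refine and_congr (forall_congr' fun i => ?_) ?_
  · have e : (1 - L) / n + lam i = (1 + (n : ℝ) ^ 2 * lam i / n - L) / n := by
      field_simp
      ring
    rw [e, le_div_iff₀ hpos, zero_mul, sub_nonneg]
  · have e : L * ((n : ℝ) ^ 2 / n - 1) = (n - 1) * L := by
      field_simp
    rw [e, le_div_iff₀ (pow_pos hpos 2), zero_mul, neg_le_iff_add_nonneg']
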